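/- For metric spaces $X,Y$ and a map $f:X\to Y$ let $\operatorname{dis}(f)=\sup_{x,x'\in X}|d_X(x,x')-d_Y(f(x),f(x'))|$. Let $d_{\mathrm{GH}}(X,Y)\in[0,\infty]$ be the Gromov–Hausdorff distance, i.e. the infimum of the Hausdorff distances $d_{\mathrm H}^Z(\Phi(X),\Psi(Y))$ over all metric spaces $Z$ and all isometric embeddings $\Phi:X\to Z$, $\Psi:Y\to Z$, and let $$\widehat d_{\mathrm{GH}}(X,Y)=\tfrac12\inf_{f:X\to Y,\ g:Y\to X}\max\{\operatorname{dis}(f),\operatorname{dis}(g)\}$$ be the modified Gromov–Hausdorff distance, where $f,g$ range over all (not necessarily continuous) maps. A regular simplex is a metric space, of any finite or infinite cardinality, whose nonzero distances are all equal. Theorem. Let $\Delta$ be a regular simplex and $X$ a compact metric space. Then: 1. $d_{\mathrm{GH}}(X,\Delta)\le 2\,\widehat d_{\mathrm{GH}}(X,\Delta)$, and this bound is tight: for every $C<2$ there are a finite metric space $X$ and a finite regular simplex $\Delta$ with $d_{\mathrm{GH}}(X,\Delta)> C\,\widehat d_{\mathrm{GH}}(X,\Delta)$. Explicitly, for every integer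 $n\ge 1$, if $X=\{x_1,\dots,x_{n+1}\}$ with $d_X(x_k,x_j)=|k-j|$ and $\Delta=\{y_1,y_2\}$ with $d_\Delta(y_1,y_2)=2n$, then $$\frac{d_{\mathrm{GH}}(X,\Delta)}{\widehat d_{\mathrm{GH}}(X,\Delta)}=2-\frac1n .$$ 2. $d_{\mathrm{GH}}(X,\Delta)=\widehat d_{\mathrm{GH}}(X,\Delta)$ whenever $|X|<|\Delta|$, or $|X|=|\Delta|<\infty$, or $\operatorname{diam}\Delta\le\tfrac12\operatorname{diam}X$. -/

import Mathlib

open scoped ENNReal Cardinal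

universe u v

/-- The distortion `sup_{x,x'} |d_X(x,x') - d_Y(f x, f x')|` of an arbitrary map, as an element
of `[0,∞]`. -/
noncomputable def distortion {X : Type u} {Y : Type v} [MetricSpace X] [MetricSpace Y]
    (f : X → Y) : ℝ≥0∞ :=
  ⨆ (x : X) (x' : X), ENNReal.ofReal |dist x x' - dist (f x) (f x')|

/-- The Gromov–Hausdorff distance, as an element of `[0,∞]`: the infimum of the Hausdorff
distances between isometric copies of `X` and `Y` in a common metric space `Z`. Replacing `Z` by
the union of the two copies shows that `Z` in the universe `max u v` is no restriction.
The spaces need not be compact. -/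
noncomputable def eGHDist (X : Type u) (Y : Type v) [MetricSpace X] [MetricSpace Y] : ℝ≥0∞ :=
  ⨅ (Z : Type (max u v)) (_ : MetricSpace Z) (Φ : X → Z) (Ψ : Y → Z)
    (_ : Isometry Φ) (_ : Isometry Ψ), Metric.hausdorffEDist (Set.range Φ) (Set.range Ψ)

/-- The modified Gromov–Hausdorff distance, as an element of `[0,∞]`:
`1/2 inf_{f, g} max {dis f, dis g}` over all maps `f : X → Y` and `g : Y → X`. -/
noncomputable def eMGHDist (X : Type u) (Y : Type v) [MetricSpace X] [MetricSpace Y] : ℝ≥0∞ :=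
  (⨅ (f : X → Y) (g : Y → X), max (distortion f) (distortion g)) / 2

/-- A regular simplex is a metric space (of any cardinality) all of whose nonzero distances are
equal. -/
def IsRegularSimplex (S : Type u) [MetricSpace S] : Prop :=
  ∀ x y x' y' : S, x ≠ y → x' ≠ y' → dist x y = dist x' y'

/-!
Through gluing, `2 d_GH` is the infimum of the distortions of correspondences. Let `f : X → S` and
`g : S → X` be maps into and out of a regular simplex `S`, both of distortion at most `M`. If
`diam S ≤ M`, the points of `S` missed by `f` can be matched arbitrarily, which turns `f` into a
correspondence of distortion at most `M`. In the cases of equality the only other possibility is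
`|X| = |S| < ∞`, with `g` injective and hence a bijection, whose graph is then the correspondence.
If `diam S ≤ 2 M`, the same construction loses at most a factor `2`. If `diam S > 2 M`, then `f ∘ g`
is injective, and since all bijections between subsets of `S` are isometric, `f` can be corrected
to a surjection of the same distortion, without any compactness of `X`.

For the path, any correspondence with a two-point simplex must separate two consecutive points of
the path, whereas a pair of maps need not.
-/

section ENNReal

variable {a b c : ℝ≥0∞}

theorem le_of_two_mul_le_two_mul (h : 2 * a ≤ 2 * b) : a ≤ b :=
  (ENNReal.mul_le_mul_iff_right two_ne_zero ENNReal.ofNat_ne_top).1 h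

theorem ofReal_abs_sub_le_iff {x y : ℝ} (hx : 0 ≤ x) (hy : 0 ≤ y) :
    ENNReal.ofReal |x - y| ≤ c ↔
      ENNReal.ofReal x ≤ c + ENNReal.ofReal y ∧ ENNReal.ofReal y ≤ c + ENNReal.ofReal x := by
  rcases eq_or_ne c ⊤ with rfl | hc
  · simp
  lift c to NNReal using hc
  have hc : 0 ≤ (c : ℝ) := c.2
  rw [← ENNReal.ofReal_coe_nnreal, ← ENNReal.ofReal_add hc hy, ← ENNReal.ofReal_add hc hx,
    ENNReal.ofReal_le_ofReal_iff hc, ENNReal.ofReal_le_ofReal_iff (add_nonneg hc hy),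
    ENNReal.ofReal_le_ofReal_iff (add_nonneg hc hx), abs_sub_le_iff, sub_le_iff_le_add,
    sub_le_iff_le_add]

end ENNReal

section Distortion

variable {X : Type*} {Y : Type*} {Z : Type*} [MetricSpace X] [MetricSpace Y] [MetricSpace Z]

theorem ofReal_abs_dist_sub_dist_le_iff {x x' : X} {y y' : Y} {c : ℝ≥0∞} :
    ENNReal.ofReal |dist x x' - dist y y'| ≤ c ↔
      edist x x' ≤ c + edist y y' ∧ edist y y' ≤ c + edist x x' := by
  simp only [edist_dist]
  exact ofReal_abs_sub_le_iff dist_nonneg dist_nonneg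

theorem distortion_le_iff {f : X → Y} {c : ℝ≥0∞} :
    distortion f ≤ c ↔ ∀ x x', edist x x' ≤ c + edist (f x) (f x') ∧
      edist (f x) (f x') ≤ c + edist x x' := by
  simp only [distortion, iSup_le_iff, ofReal_abs_dist_sub_dist_le_iff]

theorem edist_le_distortion_add (f : X → Y) (x x' : X) :
    edist x x' ≤ distortion f + edist (f x) (f x') :=
  (distortion_le_iff.1 le_rfl x x').1

theorem edist_map_le_distortion_add (f : X → Y) (x x' : X) :
    edist (f x) (f x') ≤ distortion f + edist x x' :=
  (distortion_le_iff.1 le_rfl x x').2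

theorem distortion_comp_le (g : Y → Z) (f : X → Y) :
    distortion (g ∘ f) ≤ distortion f + distortion g := by
  refine distortion_le_iff.2 fun x x' => ⟨?_, ?_⟩
  · calc edist x x' ≤ distortion f + edist (f x) (f x') := edist_le_distortion_add f x x'
      _ ≤ distortion f + (distortion g + edist (g (f x)) (g (f x'))) := by
        gcongr; exact edist_le_distortion_add g _ _
      _ = _ := (add_assoc _ _ _).symm
  · calc edist (g (f x)) (g (f x')) ≤ distortion g + edist (f x) (f x') :=
          edist_map_le_distortion_add g _ _
      _ ≤ distortion g + (distortion f + edist x x') := by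
        gcongr; exact edist_map_le_distortion_add f x x'
      _ = _ := by rw [← add_assoc, add_comm (distortion g)]

theorem distortion_const_le (y : Y) :
    distortion (fun _ : X => y) ≤ Metric.ediam (Set.univ : Set X) := by
  refine distortion_le_iff.2 fun x x' => ?_
  simpa using Metric.edist_le_ediam_of_mem (Set.mem_univ x) (Set.mem_univ x')

theorem ediam_univ_le_distortion_add (f : X → Y) :
    Metric.ediam (Set.univ : Set X) ≤ distortion f + Metric.ediam (Set.univ : Set Y) := by
  refine Metric.ediam_le fun x _ x' _ => (edist_le_distortion_add f x x').trans ?_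
  gcongr
  exact Metric.edist_le_ediam_of_mem (Set.mem_univ _) (Set.mem_univ _)

/-- A correspondence between `X` and `Y`, encoded as its set of pairs: every point of either space
is related to at least one point of the other. -/
def IsCorrespondence (R : Set (X × Y)) : Prop :=
  (∀ x, ∃ y, (x, y) ∈ R) ∧ ∀ y, ∃ x, (x, y) ∈ R

/-- The distortion of a relation, as an element of `[0,∞]`; the distortion of a map is that of its
graph. -/
noncomputable def relDistortion (R : Set (X × Y)) : ℝ≥0∞ :=
  ⨆ p ∈ R, ⨆ q ∈ R, ENNReal.ofReal |dist p.1 q.1 - dist p.2 q.2|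

theorem relDistortion_le_iff {R : Set (X × Y)} {c : ℝ≥0∞} :
    relDistortion R ≤ c ↔ ∀ p ∈ R, ∀ q ∈ R,
      edist p.1 q.1 ≤ c + edist p.2 q.2 ∧ edist p.2 q.2 ≤ c + edist p.1 q.1 := by
  simp only [relDistortion, iSup_le_iff, ofReal_abs_dist_sub_dist_le_iff]

theorem edist_snd_le_relDistortion_add {R : Set (X × Y)} {p q : X × Y} (hp : p ∈ R) (hq : q ∈ R) :
    edist p.2 q.2 ≤ relDistortion R + edist p.1 q.1 :=
  (relDistortion_le_iff.1 le_rfl p hp q hq).2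

theorem distortion_le_relDistortion {R : Set (X × Y)} {f : X → Y} (hf : ∀ x, (x, f x) ∈ R) :
    distortion f ≤ relDistortion R :=
  distortion_le_iff.2 fun x x' => relDistortion_le_iff.1 le_rfl (x, f x) (hf x) (x', f x') (hf x')

theorem distortion_le_relDistortion_of_swap_mem {R : Set (X × Y)} {g : Y → X}
    (hg : ∀ y, (g y, y) ∈ R) : distortion g ≤ relDistortion R :=
  distortion_le_iff.2 fun y y' =>
    (relDistortion_le_iff.1 le_rfl (g y, y) (hg y) (g y', y') (hg y')).symm

end Distortion

section GromovHausdorff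

variable {X : Type u} {Y : Type v} [MetricSpace X] [MetricSpace Y]

theorem eGHDist_le_hausdorffEDist {Z : Type (max u v)} [m : MetricSpace Z] {Φ : X → Z} {Ψ : Y → Z}
    (hΦ : Isometry Φ) (hΨ : Isometry Ψ) :
    eGHDist X Y ≤ Metric.hausdorffEDist (Set.range Φ) (Set.range Ψ) :=
  (iInf₂_le Z m).trans <| (iInf₂_le Φ Ψ).trans <| iInf₂_le hΦ hΨ

theorem eGHDist_eq_zero_of_isEmpty [IsEmpty X] [IsEmpty Y] : eGHDist X Y = 0 := by
  have h := eGHDist_le_hausdorffEDist (X := X) (Y := Y) (Z := ULift.{max u v} ℕ)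
    (Φ := isEmptyElim) (Ψ := isEmptyElim) (fun x => isEmptyElim x) (fun y => isEmptyElim y)
  rw [Set.range_eq_empty, Set.range_eq_empty, Metric.hausdorffEDist_self] at h
  exact nonpos_iff_eq_zero.1 h

/-- The two spaces are glued along `R`, placing related points at distance `r`. -/
theorem IsCorrespondence.eGHDist_le_ofReal {R : Set (X × Y)} (hR : IsCorrespondence R) {r : ℝ}
    (hr : 0 < r) (h : relDistortion R ≤ ENNReal.ofReal (2 * r)) :
    eGHDist X Y ≤ ENNReal.ofReal r := by
  rcases R.eq_empty_or_nonempty with rfl | hne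
  · have : IsEmpty X := ⟨fun x => (hR.1 x).elim fun _ => id⟩
    have : IsEmpty Y := ⟨fun y => (hR.2 y).elim fun _ => id⟩
    simp [eGHDist_eq_zero_of_isEmpty]
  have : Nonempty R := hne.to_subtype
  let Φ : R → X := fun p => p.1.1
  let Ψ : R → Y := fun p => p.1.2
  have hdist : ∀ p q : R, |dist (Φ p) (Φ q) - dist (Ψ p) (Ψ q)| ≤ 2 * r := fun p q => by
    rw [← ENNReal.ofReal_le_ofReal_iff (by positivity)]
    exact ofReal_abs_dist_sub_dist_le_iff.2 (relDistortion_le_iff.1 h p p.2 q q.2)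
  let : MetricSpace (X ⊕ Y) := Metric.glueMetricApprox Φ Ψ r hr hdist
  have hinl : Isometry (Sum.inl : X → X ⊕ Y) := Isometry.of_dist_eq fun _ _ => rfl
  have hinr : Isometry (Sum.inr : Y → X ⊕ Y) := Isometry.of_dist_eq fun _ _ => rfl
  have hrel : ∀ {x y}, (x, y) ∈ R →
      edist (Sum.inl x : X ⊕ Y) (Sum.inr y) ≤ ENNReal.ofReal r := fun {x y} hxy => by
    rw [edist_dist]
    exact ENNReal.ofReal_le_ofReal (Metric.glueDist_glued_points Φ Ψ r ⟨(x, y), hxy⟩).le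
  refine (eGHDist_le_hausdorffEDist hinl hinr).trans (Metric.hausdorffEDist_le_of_mem_edist ?_ ?_)
  · rintro _ ⟨x, rfl⟩
    obtain ⟨y, hxy⟩ := hR.1 x
    exact ⟨_, ⟨y, rfl⟩, hrel hxy⟩
  · rintro _ ⟨y, rfl⟩
    obtain ⟨x, hxy⟩ := hR.2 y
    exact ⟨_, ⟨x, rfl⟩, edist_comm (Sum.inl x : X ⊕ Y) _ ▸ hrel hxy⟩

theorem IsCorrespondence.two_mul_eGHDist_le {R : Set (X × Y)} (hR : IsCorrespondence R) :
    2 * eGHDist X Y ≤ relDistortion R := by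
  refine le_of_forall_gt_imp_ge_of_dense fun d hd => ?_
  rcases eq_or_ne d ⊤ with rfl | hd_top
  · exact le_top
  have hd_pos : 0 < d.toReal := ENNReal.toReal_pos hd.ne_bot hd_top
  calc 2 * eGHDist X Y ≤ 2 * ENNReal.ofReal (d.toReal / 2) := by
        gcongr
        refine hR.eGHDist_le_ofReal (half_pos hd_pos) ?_
        rw [mul_div_cancel₀ _ two_ne_zero, ENNReal.ofReal_toReal hd_top]
        exact hd.le
    _ = d := by
        rw [ENNReal.ofReal_div_of_pos two_pos, ENNReal.ofReal_toReal hd_top, ENNReal.ofReal_ofNat,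
          ENNReal.mul_div_cancel two_ne_zero ENNReal.ofNat_ne_top]

theorem isCorrespondence_setOf_edist_lt {X Y Z : Type*} [MetricSpace Z] {Φ : X → Z} {Ψ : Y → Z}
    {r : ℝ≥0∞} (hr : Metric.hausdorffEDist (Set.range Φ) (Set.range Ψ) < r) :
    IsCorrespondence {p : X × Y | edist (Φ p.1) (Ψ p.2) < r} := by
  refine ⟨fun x => ?_, fun y => ?_⟩
  · obtain ⟨_, ⟨y, rfl⟩, hxy⟩ :=
      Metric.exists_edist_lt_of_hausdorffEDist_lt (Set.mem_range_self x) hr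
    exact ⟨y, hxy⟩
  · rw [Metric.hausdorffEDist_comm] at hr
    obtain ⟨_, ⟨x, rfl⟩, hyx⟩ :=
      Metric.exists_edist_lt_of_hausdorffEDist_lt (Set.mem_range_self y) hr
    exact ⟨x, (edist_comm _ _).trans_lt hyx⟩

theorem relDistortion_setOf_edist_lt_le {Z : Type*} [MetricSpace Z] {Φ : X → Z} {Ψ : Y → Z}
    (hΦ : Isometry Φ) (hΨ : Isometry Ψ) (r : ℝ≥0∞) :
    relDistortion {p : X × Y | edist (Φ p.1) (Ψ p.2) < r} ≤ 2 * r := by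
  refine relDistortion_le_iff.2 fun p hp q hq => ⟨?_, ?_⟩
  · rw [← hΦ.edist_eq, ← hΨ.edist_eq]
    calc edist (Φ p.1) (Φ q.1)
        ≤ edist (Φ p.1) (Ψ p.2) + edist (Ψ p.2) (Ψ q.2) + edist (Ψ q.2) (Φ q.1) :=
          edist_triangle4 _ _ _ _
      _ ≤ r + edist (Ψ p.2) (Ψ q.2) + r := by
        rw [edist_comm (Ψ q.2)]; gcongr; exacts [hp.le, hq.le]
      _ = 2 * r + edist (Ψ p.2) (Ψ q.2) := by ring
  · rw [← hΦ.edist_eq, ← hΨ.edist_eq]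
    calc edist (Ψ p.2) (Ψ q.2)
        ≤ edist (Ψ p.2) (Φ p.1) + edist (Φ p.1) (Φ q.1) + edist (Φ q.1) (Ψ q.2) :=
          edist_triangle4 _ _ _ _
      _ ≤ r + edist (Φ p.1) (Φ q.1) + r := by
        rw [edist_comm (Ψ p.2)]; gcongr; exacts [hp.le, hq.le]
      _ = 2 * r + edist (Φ p.1) (Φ q.1) := by ring

theorem two_mul_eGHDist (X : Type u) (Y : Type v) [MetricSpace X] [MetricSpace Y] :
    2 * eGHDist X Y = ⨅ (R : Set (X × Y)) (_ : IsCorrespondence R), relDistortion R := by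
  refine le_antisymm (le_iInf₂ fun R hR => hR.two_mul_eGHDist_le) ?_
  rw [mul_comm, ← ENNReal.div_le_iff_le_mul (.inl two_ne_zero) (.inl ENNReal.ofNat_ne_top)]
  refine le_iInf₂ fun Z _ => le_iInf₂ fun Φ Ψ => le_iInf₂ fun hΦ hΨ => ?_
  refine le_of_forall_gt_imp_ge_of_dense fun r hr => ?_
  rw [ENNReal.div_le_iff_le_mul (.inl two_ne_zero) (.inl ENNReal.ofNat_ne_top), mul_comm]
  exact iInf₂_le_of_le _ (isCorrespondence_setOf_edist_lt hr)
    (relDistortion_setOf_edist_lt_le hΦ hΨ r)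

theorem two_mul_eMGHDist (X : Type u) (Y : Type v) [MetricSpace X] [MetricSpace Y] :
    2 * eMGHDist X Y = ⨅ (f : X → Y) (g : Y → X), max (distortion f) (distortion g) := by
  rw [eMGHDist, ENNReal.mul_div_cancel two_ne_zero ENNReal.ofNat_ne_top]

theorem two_mul_eMGHDist_le (f : X → Y) (g : Y → X) :
    2 * eMGHDist X Y ≤ max (distortion f) (distortion g) := by
  rw [two_mul_eMGHDist]
  exact iInf_le_of_le f (iInf_le _ g)

theorem eMGHDist_le_eGHDist : eMGHDist X Y ≤ eGHDist X Y := by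
  refine le_of_two_mul_le_two_mul ?_
  rw [two_mul_eGHDist]
  refine le_iInf₂ fun R hR => ?_
  choose f hf using hR.1
  choose g hg using hR.2
  exact (two_mul_eMGHDist_le f g).trans <|
    max_le (distortion_le_relDistortion hf) (distortion_le_relDistortion_of_swap_mem hg)

theorem two_mul_eGHDist_le_of_surjective {f : X → Y} (hf : Function.Surjective f) :
    2 * eGHDist X Y ≤ distortion f := by
  have hgraph : IsCorrespondence {p : X × Y | f p.1 = p.2} := ⟨fun x => ⟨f x, rfl⟩, hf⟩
  refine hgraph.two_mul_eGHDist_le.trans (relDistortion_le_iff.2 ?_)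
  rintro ⟨x, y⟩ (rfl : f x = y) ⟨x', y'⟩ (rfl : f x' = y')
  exact distortion_le_iff.1 le_rfl x x'

theorem eGHDist_comm (X : Type u) (Y : Type v) [MetricSpace X] [MetricSpace Y] :
    eGHDist X Y = eGHDist Y X := by
  refine iInf_congr fun Z => iInf_congr fun _ => iInf_comm.trans ?_
  refine iInf_congr fun Ψ => iInf_congr fun Φ => iInf_comm.trans ?_
  exact iInf_congr fun _ => iInf_congr fun _ => Metric.hausdorffEDist_comm

theorem ediam_univ_le_two_mul_eMGHDist_add (X : Type u) (Y : Type v) [MetricSpace X]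
    [MetricSpace Y] : Metric.ediam (Set.univ : Set Y) ≤
      2 * eMGHDist X Y + Metric.ediam (Set.univ : Set X) := by
  rw [← tsub_le_iff_right, two_mul_eMGHDist]
  refine le_iInf₂ fun f g => ?_
  rw [tsub_le_iff_right]
  exact (ediam_univ_le_distortion_add g).trans (by gcongr; exact le_max_right _ _)

end GromovHausdorff

section IsometryEquiv

universe u' v'

variable {X : Type u} {Y : Type v} {X' : Type u'} {Y' : Type v'}
  [MetricSpace X] [MetricSpace Y] [MetricSpace X'] [MetricSpace Y']

theorem eGHDist_le_of_isometryEquiv (e : X ≃ᵢ X') (e' : Y ≃ᵢ Y') :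
    eGHDist X Y ≤ eGHDist X' Y' := by
  refine le_of_two_mul_le_two_mul ?_
  rw [two_mul_eGHDist X' Y']
  refine le_iInf₂ fun R hR => ?_
  have hpre : IsCorrespondence (Prod.map e e' ⁻¹' R) :=
    ⟨fun x => (e'.surjective.exists).1 (hR.1 (e x)), fun y => (e.surjective.exists).1 (hR.2 (e' y))⟩
  refine hpre.two_mul_eGHDist_le.trans (relDistortion_le_iff.2 fun p hp q hq => ?_)
  have := relDistortion_le_iff.1 (le_refl (relDistortion R)) _ hp _ hq
  simpa only [Prod.map_fst, Prod.map_snd, e.edist_eq, e'.edist_eq] using this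

theorem eGHDist_congr (e : X ≃ᵢ X') (e' : Y ≃ᵢ Y') : eGHDist X Y = eGHDist X' Y' :=
  le_antisymm (eGHDist_le_of_isometryEquiv e e') (eGHDist_le_of_isometryEquiv e.symm e'.symm)

theorem distortion_isometryEquiv_comp_le (f : X' → Y') (e : X ≃ᵢ X') (e' : Y ≃ᵢ Y') :
    distortion (e'.symm ∘ f ∘ e) ≤ distortion f := by
  refine distortion_le_iff.2 fun x x' => ?_
  simp only [Function.comp_apply, e'.symm.edist_eq, ← e.edist_eq x x']
  exact distortion_le_iff.1 le_rfl (e x) (e x')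

theorem eMGHDist_le_of_isometryEquiv (e : X ≃ᵢ X') (e' : Y ≃ᵢ Y') :
    eMGHDist X Y ≤ eMGHDist X' Y' := by
  refine le_of_two_mul_le_two_mul ?_
  rw [two_mul_eMGHDist X' Y']
  exact le_iInf₂ fun f g => (two_mul_eMGHDist_le (e'.symm ∘ f ∘ e) (e.symm ∘ g ∘ e')).trans <|
    max_le_max (distortion_isometryEquiv_comp_le f e e') (distortion_isometryEquiv_comp_le g e' e)

theorem eMGHDist_congr (e : X ≃ᵢ X') (e' : Y ≃ᵢ Y') : eMGHDist X Y = eMGHDist X' Y' :=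
  le_antisymm (eMGHDist_le_of_isometryEquiv e e') (eMGHDist_le_of_isometryEquiv e.symm e'.symm)

end IsometryEquiv

section RegularSimplex

variable {X : Type u} {S : Type v} [MetricSpace X] [MetricSpace S]

theorem IsRegularSimplex.edist_eq_ediam (hS : IsRegularSimplex S) {s t : S} (hst : s ≠ t) :
    edist s t = Metric.ediam (Set.univ : Set S) := by
  refine le_antisymm (Metric.edist_le_ediam_of_mem (Set.mem_univ _) (Set.mem_univ _))
    (Metric.ediam_le fun x _ y _ => ?_)
  rcases eq_or_ne x y with rfl | hxy
  · simp
  · rw [edist_dist, edist_dist, hS x y s t hxy hst]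

theorem IsRegularSimplex.of_isometry (hS : IsRegularSimplex S) {f : X → S} (hf : Isometry f) :
    IsRegularSimplex X := fun x y x' y' hxy hxy' => by
  rw [← hf.dist_eq, ← hf.dist_eq]
  exact hS _ _ _ _ (hf.injective.ne hxy) (hf.injective.ne hxy')

theorem IsRegularSimplex.ediam_ne_top (hS : IsRegularSimplex S) :
    Metric.ediam (Set.univ : Set S) ≠ ⊤ := by
  rcases subsingleton_or_nontrivial S with _ | _
  · simp [Metric.ediam_subsingleton Set.subsingleton_univ]
  · obtain ⟨s, t, hst⟩ := exists_pair_ne S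
    exact hS.edist_eq_ediam hst ▸ edist_ne_top s t

theorem IsRegularSimplex.injective_of_distortion_lt (hS : IsRegularSimplex S) {g : S → X}
    (hg : distortion g < Metric.ediam (Set.univ : Set S)) : Function.Injective g := by
  intro s t hst
  by_contra hne
  have := edist_le_distortion_add g s t
  rw [hst, edist_self, add_zero, hS.edist_eq_ediam hne] at this
  exact this.not_gt hg

/-- Points of `S` outside the range of `f` may be matched arbitrarily, here through `g`. -/
theorem IsRegularSimplex.two_mul_eGHDist_le_max (hS : IsRegularSimplex S) (f : X → S)
    (g : S → X) :
    2 * eGHDist X S ≤ max (distortion f) (Metric.ediam (Set.univ : Set S)) := by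
  let R : Set (X × S) := {p | p.2 = f p.1 ∨ p.2 ∉ Set.range f ∧ p.1 = g p.2}
  have hR : IsCorrespondence R := by
    refine ⟨fun x => ⟨f x, .inl rfl⟩, fun s => ?_⟩
    by_cases hs : s ∈ Set.range f
    · obtain ⟨x, rfl⟩ := hs
      exact ⟨x, .inl rfl⟩
    · exact ⟨g s, .inr ⟨hs, rfl⟩⟩
  have hfibre : ∀ {x x' s}, (x, s) ∈ R → (x', s) ∈ R → edist x x' ≤ distortion f := by
    rintro x x' s (hx | ⟨hs, hx⟩) (hx' | ⟨hs', hx'⟩)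
    · dsimp only at hx hx'
      simpa [← hx, ← hx'] using edist_le_distortion_add f x x'
    · exact absurd ⟨x, hx.symm⟩ hs'
    · exact absurd ⟨x', hx'.symm⟩ hs
    · dsimp only at hx hx'
      simp [hx, hx']
  refine hR.two_mul_eGHDist_le.trans (relDistortion_le_iff.2 ?_)
  rintro ⟨x, s⟩ hxs ⟨x', s'⟩ hxs'
  dsimp only
  constructor
  · rcases eq_or_ne s s' with rfl | hne
    · exact (hfibre hxs hxs').trans ((le_max_left _ _).trans le_self_add)
    · calc edist x x' ≤ distortion f + edist (f x) (f x') := edist_le_distortion_add f x x'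
        _ ≤ distortion f + edist s s' := by
          rw [hS.edist_eq_ediam hne]
          gcongr
          exact Metric.edist_le_ediam_of_mem (Set.mem_univ _) (Set.mem_univ _)
        _ ≤ _ := by gcongr; exact le_max_left _ _
  · exact (Metric.edist_le_ediam_of_mem (Set.mem_univ _) (Set.mem_univ _)).trans
      ((le_max_right _ _).trans le_self_add)

/-- By the Schröder–Bernstein theorem the range of `f` is in bijection with `S`, and every
bijection between two subsets of a regular simplex is isometric. -/
theorem IsRegularSimplex.two_mul_eGHDist_le_of_injective_comp (hS : IsRegularSimplex S)
    {f : X → S} {g : S → X} (hfg : Function.Injective (f ∘ g)) :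
    2 * eGHDist X S ≤ distortion f := by
  have hcodRestrict : Function.Injective (Set.rangeFactorization f ∘ g) :=
    fun s t hst => hfg (congrArg Subtype.val hst)
  obtain ⟨e⟩ := Function.Embedding.antisymm (.subtype (· ∈ Set.range f)) ⟨_, hcodRestrict⟩
  have he : ∀ s t, edist (e s) (e t) = edist s t := by
    intro s t
    rcases eq_or_ne s t with rfl | hst
    · simp
    · rw [hS.edist_eq_ediam (e.injective.ne hst), Subtype.edist_eq,
        hS.edist_eq_ediam (Subtype.val_injective.ne hst)]
  have hsurj : Function.Surjective (e ∘ Set.rangeFactorization f) :=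
    e.surjective.comp Set.rangeFactorization_surjective
  refine (two_mul_eGHDist_le_of_surjective hsurj).trans (distortion_le_iff.2 fun x x' => ?_)
  simp only [Function.comp_apply, he, Subtype.edist_eq, Set.rangeFactorization_coe]
  exact distortion_le_iff.1 le_rfl x x'

theorem IsRegularSimplex.eGHDist_le_max_distortion (hS : IsRegularSimplex S) (f : X → S)
    (g : S → X) : eGHDist X S ≤ max (distortion f) (distortion g) := by
  set M := max (distortion f) (distortion g)
  have hf : distortion f ≤ 2 * M := (le_max_left _ _).trans (le_mul_of_one_le_left' one_le_two)
  refine le_of_two_mul_le_two_mul ?_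
  rcases le_or_gt (Metric.ediam (Set.univ : Set S)) (2 * M) with hle | hlt
  · exact (hS.two_mul_eGHDist_le_max f g).trans (max_le hf hle)
  · have hfg : distortion (f ∘ g) ≤ 2 * M := by
      rw [two_mul]
      exact (distortion_comp_le f g).trans (add_le_add (le_max_right _ _) (le_max_left _ _))
    exact (hS.two_mul_eGHDist_le_of_injective_comp
      (hS.injective_of_distortion_lt (hfg.trans_lt hlt))).trans hf

theorem IsRegularSimplex.eGHDist_le_two_mul_eMGHDist (hS : IsRegularSimplex S) :
    eGHDist X S ≤ 2 * eMGHDist X S := by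
  rw [two_mul_eMGHDist]
  exact le_iInf₂ hS.eGHDist_le_max_distortion

theorem IsRegularSimplex.eGHDist_eq_eMGHDist_of_forall (hS : IsRegularSimplex S)
    (h : ∀ (f : X → S) (g : S → X),
      max (distortion f) (distortion g) < Metric.ediam (Set.univ : Set S) →
        2 * eGHDist X S ≤ max (distortion f) (distortion g)) :
    eGHDist X S = eMGHDist X S := by
  refine le_antisymm (le_of_two_mul_le_two_mul ?_) eMGHDist_le_eGHDist
  rw [two_mul_eMGHDist]
  refine le_iInf₂ fun f g => ?_
  rcases lt_or_ge (max (distortion f) (distortion g)) (Metric.ediam (Set.univ : Set S)) with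
    hlt | hle
  · exact h f g hlt
  · exact (hS.two_mul_eGHDist_le_max f g).trans (max_le (le_max_left _ _) hle)

theorem IsRegularSimplex.eGHDist_eq_eMGHDist_of_lift_mk_lt (hS : IsRegularSimplex S)
    (hXS : Cardinal.lift.{v} #X < Cardinal.lift.{u} #S) : eGHDist X S = eMGHDist X S := by
  refine hS.eGHDist_eq_eMGHDist_of_forall fun f g hlt => absurd hXS (not_lt.2 ?_)
  exact Cardinal.lift_mk_le_lift_mk_of_injective
    (hS.injective_of_distortion_lt ((le_max_right _ _).trans_lt hlt))

theorem IsRegularSimplex.eGHDist_eq_eMGHDist_of_lift_mk_eq [Finite S] (hS : IsRegularSimplex S)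
    (hXS : Cardinal.lift.{v} #X = Cardinal.lift.{u} #S) : eGHDist X S = eMGHDist X S := by
  refine hS.eGHDist_eq_eMGHDist_of_forall fun f g hlt => ?_
  have hinj := hS.injective_of_distortion_lt ((le_max_right _ _).trans_lt hlt)
  obtain ⟨e⟩ := Cardinal.lift_mk_eq'.1 hXS
  have hsurj := (Finite.injective_iff_surjective_of_equiv e.symm).1 hinj
  rw [eGHDist_comm]
  exact (two_mul_eGHDist_le_of_surjective hsurj).trans (le_max_right _ _)

/-- Since `diam X ≤ dis f + diam S`, the hypothesis forces `diam S ≤ dis f` for every `f`. -/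
theorem IsRegularSimplex.eGHDist_eq_eMGHDist_of_ediam_le_half (hS : IsRegularSimplex S)
    (hXS : Metric.ediam (Set.univ : Set S) ≤ Metric.ediam (Set.univ : Set X) / 2) :
    eGHDist X S = eMGHDist X S := by
  refine hS.eGHDist_eq_eMGHDist_of_forall fun f g hlt => absurd hlt (not_lt.2 ?_)
  refine le_max_of_le_left ((ENNReal.add_le_add_iff_right hS.ediam_ne_top).1 ?_)
  rw [← two_mul, mul_comm]
  exact ((ENNReal.le_div_iff_mul_le (.inl two_ne_zero) (.inl ENNReal.ofNat_ne_top)).1 hXS).trans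
    (ediam_univ_le_distortion_add f)

theorem IsRegularSimplex.distortion_le_max_of_separated (hS : IsRegularSimplex S) {f : X → S}
    {ε : ℝ≥0∞} (hf : ∀ x x', f x ≠ f x' → ε ≤ edist x x') :
    distortion f ≤
      max (Metric.ediam (Set.univ : Set X)) (Metric.ediam (Set.univ : Set S) - ε) := by
  refine distortion_le_iff.2 fun x x' => ⟨?_, ?_⟩
  · exact (Metric.edist_le_ediam_of_mem (Set.mem_univ _) (Set.mem_univ _)).trans
      ((le_max_left _ _).trans le_self_add)
  · rcases eq_or_ne (f x) (f x') with heq | hne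
    · simp [heq]
    · rw [hS.edist_eq_ediam hne]
      exact tsub_le_iff_right.1 <| (tsub_le_tsub_left (hf x x' hne) _).trans (le_max_right _ _)

/-- If consecutive points of a chain in `X` are closer than `diam S - dis R`, then `R` relates the
whole chain to a single vertex of `S`. -/
theorem IsRegularSimplex.ediam_le_two_mul_eGHDist_add (hS : IsRegularSimplex S) {ε : ℝ≥0∞}
    (hX : ∀ x x' : X, Relation.ReflTransGen (fun a b => edist a b ≤ ε) x x') :
    Metric.ediam (Set.univ : Set S) ≤ 2 * eGHDist X S + ε := by
  rw [← tsub_le_iff_right, two_mul_eGHDist]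
  refine le_iInf₂ fun R hR => ?_
  rw [tsub_le_iff_right]
  by_contra! hlt
  have hstep : ∀ p ∈ R, ∀ q ∈ R, edist p.1 q.1 ≤ ε → p.2 = q.2 := by
    intro p hp q hq hpq
    by_contra hne
    refine hlt.not_ge (hS.edist_eq_ediam hne ▸ (edist_snd_le_relDistortion_add hp hq).trans ?_)
    gcongr
  have hconst : ∀ p ∈ R, ∀ q ∈ R, p.2 = q.2 := by
    rintro ⟨x, s⟩ hp ⟨x', s'⟩ hq
    have hchain := hX x x'
    induction hchain generalizing s' with
    | refl => exact hstep _ hp _ hq (by simp)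
    | @tail y z _ hyz ih =>
      obtain ⟨t, ht⟩ := hR.1 y
      exact (ih t ht).trans (hstep _ ht _ hq hyz)
  refine hlt.ne_bot (Metric.ediam_subsingleton fun s _ t _ => ?_)
  obtain ⟨x, hx⟩ := hR.2 s
  obtain ⟨y, hy⟩ := hR.2 t
  exact hconst _ hx _ hy

end RegularSimplex

theorem ediam_le_half_of_diam_le_half {X Y : Type*} [PseudoMetricSpace X] [PseudoMetricSpace Y]
    {s : Set X} {t : Set Y} (hs : Metric.ediam s ≠ ⊤) (ht : Metric.ediam t ≠ ⊤)
    (hst : Metric.diam s ≤ 1 / 2 * Metric.diam t) : Metric.ediam s ≤ Metric.ediam t / 2 := by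
  rw [← ENNReal.toReal_le_toReal hs (ENNReal.div_ne_top ht two_ne_zero), ENNReal.toReal_div,
    ENNReal.toReal_ofNat]
  linarith! [hst]

section Path

variable {n : ℕ}

theorem isRegularSimplex_pair {M : Type*} [MetricSpace M] (a b : M) :
    IsRegularSimplex ↥({a, b} : Set M) := by
  rintro ⟨x, rfl | rfl⟩ ⟨y, rfl | rfl⟩ ⟨x', rfl | rfl⟩ ⟨y', rfl | rfl⟩ hxy hxy' <;>
    simp_all [Subtype.dist_eq, dist_comm]

theorem ediam_univ_coe {M : Type*} [PseudoEMetricSpace M] (s : Set M) :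
    Metric.ediam (Set.univ : Set s) = Metric.ediam s := by
  simpa using (isometry_subtype_coe (s := s)).ediam_range.symm

theorem edist_nat_of_le {k j : ℕ} (hkj : k ≤ j) : edist k j = ((j - k : ℕ) : ℝ≥0∞) := by
  rw [edist_dist, dist_comm, Nat.dist_eq, ← Nat.cast_sub hkj, Nat.abs_cast, ENNReal.ofReal_natCast]

theorem one_le_edist_nat {k j : ℕ} (hkj : k ≠ j) : 1 ≤ edist k j := by
  rw [edist_dist, ENNReal.one_le_ofReal]
  exact Nat.pairwise_one_le_dist hkj

theorem edist_two_mul_nat (k j : ℕ) : edist (2 * k) (2 * j) = 2 * edist k j := by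
  simp only [edist_dist, Nat.dist_eq, Nat.cast_mul, Nat.cast_ofNat, ← mul_sub, abs_mul, abs_two,
    ENNReal.ofReal_mul zero_le_two, ENNReal.ofReal_ofNat]

theorem edist_add_one_nat (k j : ℕ) : edist (k + 1) (j + 1) = edist k j := by
  simp only [edist_dist, Nat.dist_eq, Nat.cast_add_one, add_sub_add_right_eq_sub]

theorem ediam_Icc_nat (a b : ℕ) : Metric.ediam (Set.Icc a b) = ((b - a : ℕ) : ℝ≥0∞) := by
  refine le_antisymm (Metric.ediam_le fun k hk j hj => ?_) ?_
  · wlog hkj : k ≤ j generalizing k j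
    · rw [edist_comm]
      exact this j hj k hk (le_of_not_ge hkj)
    rw [edist_nat_of_le hkj]
    gcongr
    exacts [hj.2, hk.1]
  · rcases le_total a b with hab | hba
    · rw [← edist_nat_of_le hab]
      exact Metric.edist_le_ediam_of_mem (Set.left_mem_Icc.2 hab) (Set.right_mem_Icc.2 hab)
    · simp [Nat.sub_eq_zero_of_le hba]

theorem reflTransGen_edist_le_one (s : Set ℕ) [s.OrdConnected] (x y : s) :
    Relation.ReflTransGen (fun a b => edist a b ≤ 1) x y := by
  have hsucc : ∀ i j : s, i < j → edist i (Order.succ i) ≤ 1 := fun i j hij => by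
    have hmem : Order.succ (i : ℕ) ∈ s := not_imp_comm.1 isMax_of_succ_notMem hij.not_isMax
    rw [Subtype.edist_eq, coe_succ_of_mem hmem, edist_nat_of_le (Order.le_succ _)]
    simp
  exact reflTransGen_of_succ _ (fun i hi => hsucc i y hi.2)
    fun i hi => edist_comm i (Order.succ i) ▸ hsucc i x hi.2

theorem ediam_univ_path : Metric.ediam (Set.univ : Set (Set.Icc 1 (n + 1) : Set ℕ)) = n := by
  rw [ediam_univ_coe, ediam_Icc_nat, Nat.add_sub_cancel]

theorem ediam_univ_pair : Metric.ediam (Set.univ : Set ({0, 2 * n} : Set ℕ)) = 2 * n := by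
  rw [ediam_univ_coe, Metric.ediam_pair, edist_nat_of_le (Nat.zero_le _)]
  simp

theorem two_mul_eGHDist_path_pair (hn : 1 ≤ n) :
    2 * eGHDist ↥(Set.Icc 1 (n + 1) : Set ℕ) ↥({0, 2 * n} : Set ℕ) = 2 * n - 1 := by
  have hS := isRegularSimplex_pair 0 (2 * n)
  refine le_antisymm ?_ ?_
  · let f : (Set.Icc 1 (n + 1) : Set ℕ) → ({0, 2 * n} : Set ℕ) := fun x =>
      if (x : ℕ) = 1 then ⟨0, by simp⟩ else ⟨2 * n, by simp⟩
    have hsurj : Function.Surjective f := by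
      rintro ⟨_, rfl | rfl⟩
      · exact ⟨⟨1, by simp⟩, by simp [f]⟩
      · exact ⟨⟨2, by simp [hn]⟩, by simp [f]⟩
    have hsep : ∀ x x', f x ≠ f x' → 1 ≤ edist x x' := fun x x' hne =>
      one_le_edist_nat fun h => hne (congrArg f (Subtype.ext h))
    refine (two_mul_eGHDist_le_of_surjective hsurj).trans
      ((hS.distortion_le_max_of_separated hsep).trans ?_)
    rw [ediam_univ_path, ediam_univ_pair]
    refine max_le (ENNReal.le_sub_of_add_le_right ENNReal.one_ne_top ?_) le_rfl
    exact_mod_cast (by omega : n + 1 ≤ 2 * n)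
  · rw [tsub_le_iff_right, ← ediam_univ_pair]
    exact hS.ediam_le_two_mul_eGHDist_add (reflTransGen_edist_le_one _)

/-- The upper bound comes from a constant map and from the dilation of ratio `1/2` of the pair onto
the endpoints of the path. -/
theorem two_mul_eMGHDist_path_pair (n : ℕ) :
    2 * eMGHDist ↥(Set.Icc 1 (n + 1) : Set ℕ) ↥({0, 2 * n} : Set ℕ) = n := by
  refine le_antisymm ?_ ?_
  · let g : ({0, 2 * n} : Set ℕ) → (Set.Icc 1 (n + 1) : Set ℕ) := fun s =>
      ⟨s / 2 + 1, by obtain ⟨_, rfl | rfl⟩ := s <;> simp⟩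
    have heven : ∀ s : ({0, 2 * n} : Set ℕ), 2 * ((s : ℕ) / 2) = s := by
      rintro ⟨_, rfl | rfl⟩ <;> simp
    have hhalf : ∀ s s', edist s s' = edist (g s) (g s') + edist (g s) (g s') := fun s s' => by
      rw [Subtype.edist_eq, ← heven s, ← heven s', edist_two_mul_nat, ← two_mul]
      exact congrArg (2 * ·) (edist_add_one_nat _ _).symm
    have hle : ∀ s s', edist (g s) (g s') ≤ n := fun s s' =>
      ediam_univ_path (n := n) ▸ Metric.edist_le_ediam_of_mem (Set.mem_univ _) (Set.mem_univ _)
    refine (two_mul_eMGHDist_le (fun _ => ⟨0, by simp⟩) g).trans (max_le ?_ ?_)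
    · exact (distortion_const_le _).trans_eq ediam_univ_path
    · refine distortion_le_iff.2 fun s s' => ?_
      rw [hhalf s s']
      exact ⟨add_le_add_left (hle s s') _, le_add_left le_self_add⟩
  · have h := ediam_univ_le_two_mul_eMGHDist_add
      ↥(Set.Icc 1 (n + 1) : Set ℕ) ↥({0, 2 * n} : Set ℕ)
    rw [ediam_univ_path, ediam_univ_pair, two_mul (n : ℝ≥0∞)] at h
    exact (ENNReal.add_le_add_iff_right (ENNReal.natCast_ne_top n)).1 h

theorem eGHDist_div_eMGHDist_path_pair (hn : 1 ≤ n) :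
    eGHDist ↥(Set.Icc 1 (n + 1) : Set ℕ) ↥({0, 2 * n} : Set ℕ) /
        eMGHDist ↥(Set.Icc 1 (n + 1) : Set ℕ) ↥({0, 2 * n} : Set ℕ) =
      ENNReal.ofReal (2 - 1 / (n : ℝ)) := by
  have hn' : (0 : ℝ) < n := by exact_mod_cast hn
  rw [← ENNReal.mul_div_mul_left _ _ two_ne_zero ENNReal.ofNat_ne_top,
    two_mul_eGHDist_path_pair hn, two_mul_eMGHDist_path_pair]
  calc (2 * n - 1 : ℝ≥0∞) / n = ENNReal.ofReal (2 * n - 1) / ENNReal.ofReal n := by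
        rw [ENNReal.ofReal_sub _ zero_le_one, ENNReal.ofReal_mul zero_le_two]
        simp
    _ = ENNReal.ofReal ((2 * n - 1) / n) := (ENNReal.ofReal_div_of_pos hn').symm
    _ = ENNReal.ofReal (2 - 1 / n) := by congr 1; field_simp

theorem exists_lt_ofReal_two_sub_one_div {C : ℝ≥0∞} (hC : C < 2) :
    ∃ n : ℕ, 1 ≤ n ∧ C < ENNReal.ofReal (2 - 1 / (n : ℝ)) := by
  have hlim : Filter.Tendsto (fun n : ℕ => ENNReal.ofReal (2 - 1 / (n : ℝ))) Filter.atTop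
      (nhds (ENNReal.ofReal (2 - 0))) :=
    ENNReal.tendsto_ofReal (tendsto_const_nhds.sub tendsto_one_div_atTop_nhds_zero_nat)
  rw [sub_zero, ENNReal.ofReal_ofNat] at hlim
  exact ((Filter.eventually_ge_atTop 1).and (hlim.eventually_const_lt hC)).exists

theorem exists_mul_eMGHDist_lt_eGHDist {C : ℝ≥0∞} (hC : C < 2) :
    ∃ (X : Type u) (S : Type v) (_ : MetricSpace X) (_ : MetricSpace S),
      Finite X ∧ Nonempty X ∧ Finite S ∧ Nonempty S ∧ IsRegularSimplex S ∧
        C * eMGHDist X S < eGHDist X S := by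
  obtain ⟨n, hn, hCn⟩ := exists_lt_ofReal_two_sub_one_div hC
  let X := ↥(Set.Icc 1 (n + 1) : Set ℕ)
  let S := ↥({0, 2 * n} : Set ℕ)
  let eX : ULift.{u} X ≃ᵢ X := ⟨Equiv.ulift, fun _ _ => rfl⟩
  let eS : ULift.{v} S ≃ᵢ S := ⟨Equiv.ulift, fun _ _ => rfl⟩
  have hS : IsRegularSimplex (ULift.{v} S) :=
    (isRegularSimplex_pair 0 (2 * n)).of_isometry eS.isometry
  refine ⟨ULift X, ULift S, inferInstance, inferInstance, inferInstance, ⟨⟨1, by simp⟩⟩,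
    inferInstance, ⟨⟨0, by simp⟩⟩, hS, ?_⟩
  rw [eGHDist_congr eX eS, eMGHDist_congr eX eS]
  exact ENNReal.mul_lt_of_lt_div (hCn.trans_eq (eGHDist_div_eMGHDist_path_pair hn).symm)

end Path

theorem mainTheorem3_general :
    (∀ (X : Type u) (S : Type v) [MetricSpace X] [MetricSpace S],
      IsRegularSimplex S → eGHDist X S ≤ 2 * eMGHDist X S) ∧
    (∀ C : ℝ≥0∞, C < 2 →
      ∃ (X : Type u) (S : Type v) (_ : MetricSpace X) (_ : MetricSpace S),
        Finite X ∧ Nonempty X ∧ Finite S ∧ Nonempty S ∧ IsRegularSimplex S ∧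
          C * eMGHDist X S < eGHDist X S) ∧
    (∀ n : ℕ, 1 ≤ n →
      IsRegularSimplex ↥({0, 2 * n} : Set ℕ) ∧
      eGHDist ↥(Set.Icc 1 (n + 1) : Set ℕ) ↥({0, 2 * n} : Set ℕ) /
          eMGHDist ↥(Set.Icc 1 (n + 1) : Set ℕ) ↥({0, 2 * n} : Set ℕ) =
        ENNReal.ofReal (2 - 1 / (n : ℝ))) ∧
    (∀ (X : Type u) (S : Type v) [MetricSpace X] [MetricSpace S],
      IsRegularSimplex S →
      (Cardinal.lift.{v} #X < Cardinal.lift.{u} #S ∨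
        (Cardinal.lift.{v} #X = Cardinal.lift.{u} #S ∧ #S < ℵ₀) ∨
        Metric.ediam (Set.univ : Set S) ≤ Metric.ediam (Set.univ : Set X) / 2) →
      eGHDist X S = eMGHDist X S) := by
  refine ⟨fun _ _ _ _ hS => hS.eGHDist_le_two_mul_eMGHDist,
    fun _ hC => exists_mul_eMGHDist_lt_eGHDist hC,
    fun n hn => ⟨isRegularSimplex_pair 0 (2 * n), eGHDist_div_eMGHDist_path_pair hn⟩,
    fun X S _ _ hS h => ?_⟩
  rcases h with hlt | ⟨heq, hfin⟩ | hdiam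
  · exact hS.eGHDist_eq_eMGHDist_of_lift_mk_lt hlt
  · have : Finite S := Cardinal.lt_aleph0_iff_finite.1 hfin
    exact hS.eGHDist_eq_eMGHDist_of_lift_mk_eq heq
  · exact hS.eGHDist_eq_eMGHDist_of_ediam_le_half hdiam

theorem mainTheorem3 :
    -- the bound
    (∀ (X : Type u) (S : Type v) [MetricSpace X] [CompactSpace X] [MetricSpace S],
      IsRegularSimplex S → eGHDist X S ≤ 2 * eMGHDist X S) ∧
    -- the constant `2` cannot be lowered, not even for finite spaces
    (∀ C : ℝ≥0∞, C < 2 →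
      ∃ (X : Type u) (S : Type v) (_ : MetricSpace X) (_ : MetricSpace S),
        Finite X ∧ Nonempty X ∧ Finite S ∧ Nonempty S ∧ IsRegularSimplex S ∧
          C * eMGHDist X S < eGHDist X S) ∧
    -- the path `{1, …, n + 1}` with `d(k, j) = |k - j|` against two points at distance `2n`
    (∀ n : ℕ, 1 ≤ n →
      IsRegularSimplex ↥({0, 2 * n} : Set ℕ) ∧
      eGHDist ↥(Set.Icc 1 (n + 1) : Set ℕ) ↥({0, 2 * n} : Set ℕ) /
          eMGHDist ↥(Set.Icc 1 (n + 1) : Set ℕ) ↥({0, 2 * n} : Set ℕ) =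
        ENNReal.ofReal (2 - 1 / (n : ℝ))) ∧
    -- the cases of equality
    (∀ (X : Type u) (S : Type v) [MetricSpace X] [CompactSpace X] [MetricSpace S],
      IsRegularSimplex S →
      (Cardinal.lift.{v} #X < Cardinal.lift.{u} #S ∨
        (Cardinal.lift.{v} #X = Cardinal.lift.{u} #S ∧ #S < ℵ₀) ∨
        Metric.diam (Set.univ : Set S) ≤ 1 / 2 * Metric.diam (Set.univ : Set X)) →
      eGHDist X S = eMGHDist X S) := by
  obtain ⟨bound, tight, path, equality⟩ := mainTheorem3_general.{u, v}
  refine ⟨fun X S _ _ _ => bound X S, tight, path, fun X S _ _ _ hS h => equality X S hS ?_⟩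
  exact h.imp_right (Or.imp_right (ediam_le_half_of_diam_le_half hS.ediam_ne_top
    isCompact_univ.isBounded.ediam_ne_top))
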